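/- Let $t,N$ be integers with $N\ge t\ge 0$, and let $S_t$ be the symmetric group on $t$ letters with neutral element $e$. For $\sigma\in S_t$ let $|\sigma|$ be the number of cycles of $\sigma$, fixed points included. For an irreducible complex character $\chi$ of $S_t$ put $$f_\chi(N):=\sum_{\sigma\in S_t}\frac{\chi(\sigma)\,N^{|\sigma|}}{\chi(e)},$$ and define $$V_N(\sigma):=\sum_{\chi}\frac{\chi(e)}{t!\,f_\chi(N)}\,\chi(\sigma)\qquad(\sigma\in S_t),$$ where $\chi$ runs over the irreducible complex characters of $S_t$. For $\alpha\in S_t$ define functions $q_\alpha,V_\alpha:S_t\to\mathbb C$ by $$q_\alpha(\sigma):=N^{|\sigma^{-1}\alpha|},\qquad V_\alpha(\sigma):=V_N(\sigma^{-1}\alpha)\qquad(\sigma\in S_t).$$ Equip the vector space $\mathbb C[S_t]$ of functions $S_t\to\mathbb C$ with the inner product $\langle f_1,f_2\rangle:=\sum_{\sigma\in S_t}\overline{f_1(\sigma)}f_2(\sigma)$. Then: 1. $f_\chi(N)\neq 0$ for every irreducible character $\chi$ of $S_t$, so that $V_N$ is well defined. 2. $(q_\alpha)_{\alpha\in S_t}$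 is a basis of $\mathbb C[S_t]$, and $(V_\alpha)_{\alpha\in S_t}$ is a basis dual to it: $\langle V_\alpha,q_\beta\rangle=\delta_{\alpha\beta}$ for all $\alpha,\beta\in S_t$. 3. For every $\alpha\in S_t$, $$\sum_{\sigma\in S_t}V_N(\alpha\sigma^{-1})\,N^{|\sigma|}=\begin{cases}1,&\alpha=e,\\0,&\alpha\ne e.\end{cases}$$ -/

import Mathlib

namespace CUE

open scoped Nat ComplexConjugate

/-- `cyc σ` is the number of cycles of `σ`, fixed points included: the number of atoms of the
partition of `[t]` into sets of points that lie in the same cycle of `σ`. -/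
noncomputable def cyc {t : ℕ} (σ : Equiv.Perm (Fin t)) : ℕ :=
  Nat.card (Quotient (Equiv.Perm.SameCycle.setoid σ))

/-- `χ` is the character of an irreducible complex representation of `G` (every
finite-dimensional one can be realised on some `ℂⁿ`). -/
def IsIrrChar {G : Type*} [Group G] (χ : G → ℂ) : Prop :=
  ∃ (n : ℕ) (ρ : Representation ℂ G (Fin n → ℂ)), ρ.IsIrreducible ∧ ρ.character = χ

/-- The set of irreducible complex characters of `G`. -/
def IrrChar (G : Type*) [Group G] : Type _ :=
  {χ : G → ℂ // IsIrrChar χ}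

theorem irrChar_linearIndependent (G : Type*) [Group G] [Finite G] :
    LinearIndependent ℂ (fun χ : IrrChar G => χ.1) := by
  classical
  have := Fintype.ofFinite G
  have hc : (Nat.card G : ℂ) ≠ 0 := by exact_mod_cast Nat.card_pos.ne'
  let _ : Invertible (Nat.card G : ℂ) := invertibleOfNonzero hc
  have key : ∀ χ ψ : IrrChar G, (Nat.card G : ℂ)⁻¹ * ∑ g : G, χ.1 g * ψ.1 g⁻¹ =
      if χ = ψ then 1 else 0 := by
    rintro ⟨χ, n, ρ, hρ, rfl⟩ ⟨ψ, m, τ, hτ, rfl⟩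
    have h := Representation.char_orthonormal ρ τ
    dsimp only
    split_ifs with he
    · have he' : ρ.character = τ.character := congrArg Subtype.val he
      have h2 := Representation.char_orthonormal ρ ρ
      rw [if_pos ⟨Representation.Equiv.refl ρ⟩] at h2
      rw [← he']
      exact h2
    · rw [h, if_neg]
      rintro ⟨e⟩
      exact he (Subtype.ext (Representation.char_iso e).symm)
  rw [linearIndependent_iff']
  intro s c hs χ hχ
  have h1 : (Nat.card G : ℂ)⁻¹ * ∑ g : G, (∑ ψ ∈ s, c ψ • ψ.1) g * χ.1 g⁻¹ = 0 := by
    rw [hs]; simp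
  have h2 : (Nat.card G : ℂ)⁻¹ * ∑ g : G, (∑ ψ ∈ s, c ψ • ψ.1) g * χ.1 g⁻¹ =
      ∑ ψ ∈ s, c ψ * ((Nat.card G : ℂ)⁻¹ * ∑ g : G, ψ.1 g * χ.1 g⁻¹) := by
    simp only [Finset.sum_apply, Pi.smul_apply, smul_eq_mul, Finset.sum_mul, Finset.mul_sum]
    rw [Finset.sum_comm]
    refine Finset.sum_congr rfl fun ψ _ => Finset.sum_congr rfl fun g _ => ?_
    ring
  rw [h2] at h1
  simp only [key] at h1
  simpa [hχ] using h1

instance irrChar_finite (G : Type*) [Group G] [Finite G] : Finite (IrrChar G) :=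
  (irrChar_linearIndependent G).finite

noncomputable instance irrChar_fintype (G : Type*) [Group G] [Finite G] : Fintype (IrrChar G) :=
  Fintype.ofFinite _

/-- The polynomial `f_χ`, at the integer `N`: `∑_σ χ(σ) N^{|σ|} / χ(e)`. -/
noncomputable def f {t : ℕ} (χ : IrrChar (Equiv.Perm (Fin t))) (N : ℕ) : ℂ :=
  ∑ σ : Equiv.Perm (Fin t), χ.1 σ * (N : ℂ) ^ cyc σ / χ.1 1

/-- The class function `V_N` on `S_t`: the sum of `χ(e) / (t! f_χ(N)) · χ` over the
irreducible characters `χ` of `S_t`. -/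
noncomputable def V {t : ℕ} (N : ℕ) (σ : Equiv.Perm (Fin t)) : ℂ :=
  ∑ χ : IrrChar (Equiv.Perm (Fin t)), χ.1 1 / ((t ! : ℂ) * f χ N) * χ.1 σ

/-- The translates `q_α(σ) = N^{|σ⁻¹α|}` of `σ ↦ N^{|σ|}`. -/
noncomputable def qTrans {t : ℕ} (N : ℕ) (α : Equiv.Perm (Fin t)) :
    Equiv.Perm (Fin t) → ℂ :=
  fun σ => (N : ℂ) ^ cyc (σ⁻¹ * α)

/-- The translates `V_α(σ) = V_N(σ⁻¹α)` of `V_N`. -/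
noncomputable def vTrans {t : ℕ} (N : ℕ) (α : Equiv.Perm (Fin t)) :
    Equiv.Perm (Fin t) → ℂ :=
  fun σ => V N (σ⁻¹ * α)

/-- The inner product `⟨f₁, f₂⟩ = ∑_σ conj (f₁ σ) * f₂ σ` on functions `S_t → ℂ`. -/
noncomputable def pairing {t : ℕ} (f₁ f₂ : Equiv.Perm (Fin t) → ℂ) : ℂ :=
  ∑ σ : Equiv.Perm (Fin t), conj (f₁ σ) * f₂ σ

end CUE

/-! Convolution on `S_t` by the class function `N ^ cyc σ` acts on each irreducible character `χ` as
the scalar `f χ N`, by Schur's lemma (`IrrChar.sum_mul_apply_mul`). The delta function at `1` is `(t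
!)⁻¹ ∑ χ(1) χ` (`sum_irrChar_one_mul`), so dividing each coefficient by `f χ N` produces the
convolution inverse `V N`.

The scalars are nonzero because the matrix `N ^ cyc (σ⁻¹ * τ)` is positive definite for `t ≤ N`. Its
entry counts the colourings `c` with `c ∘ τ = c ∘ σ`, so it is a Gram matrix of permutation
operators, and an injective colouring shows these to be independent
(`eq_zero_of_cyc_convolution_eq_zero`).

Duality is the convolution identity after translation. Duality in both orders makes each family
independent, hence a basis by dimension. -/

namespace CUE

open scoped Nat ComplexConjugate

/-! ### Class functions and completeness of the irreducible characters -/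

section CharacterTheory

variable {G : Type*} [Group G]

/-- The action of a weight function `h : G → ℂ` on a representation: `∑ g, h g • ρ g`. -/
noncomputable def weightedSum [Fintype G] {V : Type*} [AddCommGroup V] [Module ℂ V]
    (h : G → ℂ) (ρ : Representation ℂ G V) : V →ₗ[ℂ] V :=
  ∑ g : G, h g • ρ g

theorem weightedSum_apply [Fintype G] {V : Type*} [AddCommGroup V] [Module ℂ V]
    (h : G → ℂ) (ρ : Representation ℂ G V) (v : V) :
    weightedSum h ρ v = ∑ g : G, h g • ρ g v := by
  simp [weightedSum, LinearMap.sum_apply]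

theorem weightedSum_comm [Fintype G] {V : Type*} [AddCommGroup V] [Module ℂ V]
    {h : G → ℂ} (hh : ∀ a b, h (a * b) = h (b * a)) (ρ : Representation ℂ G V) (a : G) (v : V) :
    weightedSum h ρ (ρ a v) = ρ a (weightedSum h ρ v) := by
  simp only [weightedSum_apply, map_sum, map_smul]
  refine Fintype.sum_equiv (MulAut.conj a⁻¹).toEquiv _ _ fun g => ?_
  have h1 : h (a⁻¹ * g * a) = h g := by rw [hh, mul_inv_cancel_left]
  rw [mul_assoc] at h1
  simp [h1, ← Module.End.mul_apply, ← map_mul, mul_assoc]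

/-- **Schur's lemma** for the action of a class function on an irreducible representation. -/
theorem exists_weightedSum_eq_smul_one [Fintype G] {V : Type*} [AddCommGroup V] [Module ℂ V]
    [FiniteDimensional ℂ V] {h : G → ℂ} (hh : ∀ a b, h (a * b) = h (b * a))
    (ρ : Representation ℂ G V) [ρ.IsIrreducible] :
    ∃ c : ℂ, weightedSum h ρ = c • (1 : Module.End ℂ V) := by
  let F : Representation.IntertwiningMap ρ ρ :=
    ⟨weightedSum h ρ, fun a => LinearMap.ext fun v => weightedSum_comm hh ρ a v⟩
  obtain ⟨c, hc⟩ :=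
    (Representation.IsIrreducible.algebraMap_intertwiningMap_bijective_of_isAlgClosed
      (ρ := ρ)).2 F
  refine ⟨c, ?_⟩
  have := congrArg Representation.IntertwiningMap.toLinearMap hc
  rw [Algebra.algebraMap_eq_smul_one] at this
  exact this.symm

theorem trace_weightedSum [Fintype G] {V : Type*} [AddCommGroup V] [Module ℂ V]
    (h : G → ℂ) (ρ : Representation ℂ G V) :
    LinearMap.trace ℂ V (weightedSum h ρ) = ∑ g, h g * ρ.character g := by
  simp [weightedSum, Representation.character]

theorem finrank_ne_zero_of_isIrreducible {V : Type*} [AddCommGroup V] [Module ℂ V]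
    [FiniteDimensional ℂ V] (ρ : Representation ℂ G V) [ρ.IsIrreducible] :
    (Module.finrank ℂ V : ℂ) ≠ 0 := by
  have : Nontrivial V := by
    by_contra hV
    rw [not_nontrivial_iff_subsingleton] at hV
    have : (⊥ : Subrepresentation ρ) = ⊤ :=
      Subrepresentation.toSubmodule_injective (Subsingleton.elim _ _)
    exact bot_ne_top this
  exact_mod_cast Module.finrank_pos.ne'

theorem IrrChar.one_ne_zero (χ : IrrChar G) : χ.1 1 ≠ 0 := by
  obtain ⟨χ, n, ρ, hρ, rfl⟩ := χ
  change ρ.character 1 ≠ 0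
  rw [Representation.char_one]
  exact finrank_ne_zero_of_isIrreducible ρ

/-- Convolving an irreducible character with a class function multiplies it by a scalar. -/
theorem IrrChar.sum_mul_apply_mul [Fintype G] (χ : IrrChar G) {h : G → ℂ}
    (hh : ∀ a b, h (a * b) = h (b * a)) (a : G) :
    ∑ g, h g * χ.1 (a * g) = (∑ g, χ.1 g * h g / χ.1 1) * χ.1 a := by
  have h1 := χ.one_ne_zero
  obtain ⟨χ, n, ρ, hρ, rfl⟩ := χ
  obtain ⟨c, hc⟩ := exists_weightedSum_eq_smul_one hh ρ
  have ht := trace_weightedSum h ρ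
  -- Since the weighted sum is a scalar `c`, this trace is also `c` times the character at `a`;
  -- `ht`, the case `a = 1`, determines `c`.
  have h2 : LinearMap.trace ℂ _ (ρ a * weightedSum h ρ) = ∑ g, h g * ρ.character (a * g) := by
    simp [weightedSum, Finset.mul_sum, Representation.character]
  rw [hc] at ht h2
  simp only [← Finset.sum_div]
  simp only [mul_smul_comm, mul_one, map_smul, smul_eq_mul] at h2 ht
  have h3 : LinearMap.trace ℂ (Fin n → ℂ) 1 = ρ.character 1 := by simp [Representation.character]
  rw [h3] at ht
  rw [← h2, Finset.sum_congr rfl fun g _ => mul_comm (ρ.character g) (h g), ← ht,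
    mul_div_cancel_right₀ _ h1]
  rfl

/-- `IrrChar` only sees representations on `ℂⁿ`; transport along a basis makes it applicable to the
abstract spaces of the induction below. -/
theorem isIrrChar_character {V : Type*} [AddCommGroup V] [Module ℂ V]
    [FiniteDimensional ℂ V] (ρ : Representation ℂ G V) [ρ.IsIrreducible] :
    IsIrrChar ρ.character := by
  let e : V ≃ₗ[ℂ] (Fin (Module.finrank ℂ V) → ℂ) := (Module.finBasis ℂ V).equivFun
  let τ : Representation ℂ G (Fin (Module.finrank ℂ V) → ℂ) :=
    (e.conjAlgEquiv ℂ : _ →* _).comp ρ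
  have hτ : ∀ g v, τ g (e v) = e (ρ g v) := fun g v => by simp [τ]
  let E : ρ.Equiv τ := Representation.Equiv.mk e fun g => LinearMap.ext fun v => (hτ g v).symm
  refine ⟨_, τ, ?_, (Representation.char_iso E).symm⟩
  let o : Subrepresentation τ ≃o Subrepresentation ρ :=
    { toFun := fun W => ⟨W.toSubmodule.comap e.toLinearMap, fun g v hv => by
        simpa [← hτ] using W.apply_mem_toSubmodule g hv⟩
      invFun := fun W => ⟨W.toSubmodule.comap e.symm.toLinearMap, fun g v hv => by
        have := W.apply_mem_toSubmodule g hv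
        simpa [τ] using this⟩
      left_inv := fun W => Subrepresentation.toSubmodule_injective (by ext; simp)
      right_inv := fun W => Subrepresentation.toSubmodule_injective (by ext; simp)
      map_rel_iff' := fun {W W'} => by
        constructor
        · intro hle v hv
          have := @hle (e.symm v) (by
            change e (e.symm v) ∈ W.toSubmodule
            rwa [e.apply_symm_apply])
          change e (e.symm v) ∈ W'.toSubmodule at this
          rwa [e.apply_symm_apply] at this
        · intro hle v hv
          exact hle hv }
  exact o.isSimpleOrder_iff.mpr inferInstance

/-- A class function orthogonal to all irreducible characters acts as zero on every
finite-dimensional representation. -/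
theorem weightedSum_eq_zero [Fintype G] {h : G → ℂ} (hh : ∀ a b, h (a * b) = h (b * a))
    (h0 : ∀ χ : IrrChar G, ∑ g, h g * χ.1 g = 0) (n : ℕ) :
    ∀ {V : Type*} [AddCommGroup V] [Module ℂ V] [FiniteDimensional ℂ V]
      (ρ : Representation ℂ G V), Module.finrank ℂ V = n → weightedSum h ρ = 0 := by
  induction n using Nat.strong_induction_on with
  | _ n ih =>
  intro V _ _ _ ρ hn
  by_cases hirr : ρ.IsIrreducible
  · obtain ⟨c, hc⟩ := exists_weightedSum_eq_smul_one hh ρ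
    have ht := trace_weightedSum h ρ
    rw [h0 ⟨ρ.character, isIrrChar_character ρ⟩, hc] at ht
    simp only [map_smul, LinearMap.trace_one, smul_eq_mul, mul_eq_zero,
      finrank_ne_zero_of_isIrreducible ρ, or_false] at ht
    rw [hc, ht, zero_smul]
  by_cases hV : Subsingleton V
  · exact Subsingleton.elim _ _
  rw [not_subsingleton_iff_nontrivial] at hV
  have hnt : Nontrivial (Subrepresentation ρ) :=
    ⟨⊥, ⊤, fun he => bot_ne_top (α := Submodule ℂ V)
      (congrArg Subrepresentation.toSubmodule he)⟩
  obtain ⟨W, hW, hW'⟩ : ∃ W : Subrepresentation ρ, W ≠ ⊥ ∧ W ≠ ⊤ := by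
    by_contra! hc
    exact hirr ⟨fun W => or_iff_not_imp_left.mpr (hc W)⟩
  -- Maschke's theorem: `W` has an invariant complement `U`. Both are proper, so induction on the
  -- dimension applies to each.
  have : NeZero (Nat.card G : ℂ) := ⟨by exact_mod_cast Nat.card_pos.ne'⟩
  have : ρ.IsSemisimpleRepresentation := inferInstance
  obtain ⟨U, hU⟩ := exists_isCompl W
  have hsub : ∀ X : Subrepresentation ρ, X ≠ ⊤ → ∀ v ∈ X.toSubmodule, weightedSum h ρ v = 0 := by
    intro X hX v hv
    have hlt : Module.finrank ℂ X.toSubmodule < n := by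
      rw [← hn]
      exact Submodule.finrank_lt fun he => hX (Subrepresentation.toSubmodule_injective he)
    have hz := LinearMap.congr_fun (ih _ hlt X.toRepresentation rfl) ⟨v, hv⟩
    rw [weightedSum_apply] at hz ⊢
    have := congrArg Subtype.val hz
    simpa [Subrepresentation.toRepresentation] using this
  have hU' : U ≠ ⊤ := by
    rintro rfl
    exact hW (by simpa using hU.inf_eq_bot)
  ext v
  have hv : v ∈ W.toSubmodule ⊔ U.toSubmodule := by
    rw [← Subrepresentation.toSubmodule_sup, hU.sup_eq_top]
    exact Submodule.mem_top
  obtain ⟨w, hw, u, hu, rfl⟩ := Submodule.mem_sup.mp hv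
  rw [map_add, hsub W hW' w hw, hsub U hU' u hu]
  simp

/-- The irreducible characters are complete: a class function orthogonal to all of them is zero. -/
theorem classFunction_eq_zero [Fintype G] {h : G → ℂ} (hh : ∀ a b, h (a * b) = h (b * a))
    (h0 : ∀ χ : IrrChar G, ∑ g, h g * χ.1 g = 0) : h = 0 := by
  classical
  -- In the regular representation the weighted sum sends the delta function at `1` to `h` itself.
  let ρ : Representation ℂ G (G → ℂ) :=
    { toFun := fun g => LinearMap.funLeft ℂ ℂ (fun x => g⁻¹ * x)
      map_one' := by ext; simp
      map_mul' := fun a b => by ext; simp [LinearMap.funLeft, mul_assoc] }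
  have hz := LinearMap.congr_fun (weightedSum_eq_zero hh h0 _ ρ rfl) (Pi.single 1 1)
  rw [weightedSum_apply] at hz
  funext a
  have := congrFun hz a
  simpa [ρ, LinearMap.funLeft, Pi.single_apply, inv_mul_eq_one, Finset.sum_apply] using this

theorem IrrChar.mul_comm (χ : IrrChar G) (a b : G) : χ.1 (a * b) = χ.1 (b * a) := by
  obtain ⟨χ, n, ρ, hρ, rfl⟩ := χ
  exact ρ.char_mul_comm b a

open scoped Classical in
theorem IrrChar.orthonormal [Fintype G] (χ ψ : IrrChar G) :
    (Nat.card G : ℂ)⁻¹ * ∑ g : G, χ.1 g * ψ.1 g⁻¹ = if χ = ψ then 1 else 0 := by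
  have hc : (Nat.card G : ℂ) ≠ 0 := by exact_mod_cast Nat.card_pos.ne'
  let _ : Invertible (Nat.card G : ℂ) := invertibleOfNonzero hc
  obtain ⟨χ, n, ρ, hρ, rfl⟩ := χ
  obtain ⟨ψ, m, τ, hτ, rfl⟩ := ψ
  split_ifs with he
  · have h2 := Representation.char_orthonormal ρ ρ
    rw [if_pos ⟨Representation.Equiv.refl ρ⟩] at h2
    rw [← he]
    exact h2
  · dsimp only
    rw [Representation.char_orthonormal ρ τ, if_neg]
    rintro ⟨e⟩
    exact he (Subtype.ext (Representation.char_iso e).symm)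

open scoped Classical in
/-- The decomposition of the regular character. -/
theorem sum_irrChar_one_mul [Fintype G] (a : G) :
    ∑ χ : IrrChar G, χ.1 1 * χ.1 a = if a = 1 then (Nat.card G : ℂ) else 0 := by
  have hc : (Nat.card G : ℂ) ≠ 0 := by exact_mod_cast Nat.card_pos.ne'
  -- The inverse in `χ.1 g⁻¹` matches the form of the orthogonality relations.
  let h : G → ℂ := fun g => (if g = 1 then (Nat.card G : ℂ) else 0) -
    ∑ χ : IrrChar G, χ.1 1 * χ.1 g⁻¹
  have hz : h = 0 := by
    apply classFunction_eq_zero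
    · intro a b
      have : a * b = 1 ↔ b * a = 1 := mul_eq_one_comm
      simp only [h, this, mul_inv_rev]
      congr 1
      exact Finset.sum_congr rfl fun χ _ => by rw [χ.mul_comm]
    · intro ψ
      have h1 : ∀ χ : IrrChar G, ∑ g : G, ψ.1 g * χ.1 g⁻¹ =
          if ψ = χ then (Nat.card G : ℂ) else 0 := fun χ => by
        have := ψ.orthonormal χ
        rw [inv_mul_eq_iff_eq_mul₀ hc] at this
        simpa using this
      simp only [h, sub_mul, Finset.sum_sub_distrib, ite_mul, zero_mul, Finset.sum_ite_eq',
        Finset.mem_univ, if_true, Finset.sum_mul]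
      rw [Finset.sum_comm]
      have h2 : ∀ χ : IrrChar G, ∑ g : G, χ.1 1 * χ.1 g⁻¹ * ψ.1 g =
          χ.1 1 * if ψ = χ then (Nat.card G : ℂ) else 0 := fun χ => by
        rw [← h1, Finset.mul_sum]
        exact Finset.sum_congr rfl fun g _ => by ring
      simp only [h2, mul_ite, mul_zero, Finset.sum_ite_eq, Finset.mem_univ, if_true]
      ring
  have := congrFun hz a⁻¹
  simp only [h, inv_eq_one, inv_inv, Pi.zero_apply, sub_eq_zero] at this
  exact this.symm

end CharacterTheory

/-! ### Cycle counts, colourings and the Gram matrix -/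

section Cycles

variable {t : ℕ}

theorem cyc_inv (σ : Equiv.Perm (Fin t)) : cyc σ⁻¹ = cyc σ := by
  refine Nat.card_congr (Quotient.congr (Equiv.refl _) fun a b => ?_)
  exact Equiv.Perm.sameCycle_inv

theorem cyc_mul_comm (σ τ : Equiv.Perm (Fin t)) : cyc (σ * τ) = cyc (τ * σ) := by
  refine Nat.card_congr (Quotient.congr τ fun a b => ?_)
  have h : τ * σ = τ * (σ * τ) * τ⁻¹ := by group
  change (σ * τ).SameCycle a b ↔ (τ * σ).SameCycle (τ a) (τ b)
  rw [h, Equiv.Perm.sameCycle_conj]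
  simp

/-- Colourings invariant under `σ` are colourings of the cycles of `σ`. -/
theorem card_invariant_colourings (N : ℕ) (σ : Equiv.Perm (Fin t)) :
    Fintype.card {c : Fin t → Fin N // c ∘ σ = c} = N ^ cyc σ := by
  classical
  have hz : ∀ c : Fin t → Fin N, c ∘ σ = c → ∀ a b, σ.SameCycle a b → c a = c b := by
    rintro c hc a b ⟨i, rfl⟩
    have h1 : ∀ x, c (σ x) = c x := fun x => congrFun hc x
    have h2 : ∀ x, c (σ⁻¹ x) = c x := fun x => by rw [← h1 (σ⁻¹ x)]; simp
    induction i using Int.induction_on with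
    | zero => simp
    | succ i ih => rw [add_comm, zpow_add, zpow_one, Equiv.Perm.mul_apply, h1, ih]
    | pred i ih =>
      rw [sub_eq_add_neg, add_comm, zpow_add, zpow_neg_one, Equiv.Perm.mul_apply, h2, ih]
  let e : {c : Fin t → Fin N // c ∘ σ = c} ≃
      (Quotient (Equiv.Perm.SameCycle.setoid σ) → Fin N) :=
    { toFun := fun c => Quotient.lift c.1 (hz c.1 c.2)
      invFun := fun d => ⟨fun x => d (Quotient.mk _ x), funext fun x =>
        congrArg d (Quotient.sound (Equiv.Perm.SameCycle.symm ⟨1, by simp⟩))⟩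
      left_inv := fun c => rfl
      right_inv := fun d => funext fun x => by
        induction x using Quotient.inductionOn
        rfl }
  rw [← Nat.card_eq_fintype_card, Nat.card_congr e, Nat.card_fun, cyc]
  simp

/-- For `t ≤ N` the matrix `N ^ cyc (σ⁻¹ * τ)` is nonsingular: it is the Gram matrix of the
linearly independent family of operators by which `S_t` permutes the colourings of `t` points
with `N` colours. -/
theorem eq_zero_of_cyc_convolution_eq_zero {N : ℕ} (htN : t ≤ N)
    (x : Equiv.Perm (Fin t) → ℂ)
    (hx : ∀ σ, ∑ τ, (N : ℂ) ^ cyc (σ⁻¹ * τ) * x τ = 0) : x = 0 := by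
  classical
  -- Matrix entries of the combination, with coefficients `x`, of the operators permuting
  -- colourings.
  let w : (Fin t → Fin N) → (Fin t → Fin N) → ℂ :=
    fun c d => ∑ τ : Equiv.Perm (Fin t), if c ∘ τ = d then x τ else 0
  have hcount : ∀ σ τ : Equiv.Perm (Fin t), (N : ℂ) ^ cyc (σ⁻¹ * τ) =
      ∑ c : Fin t → Fin N, if c ∘ τ = c ∘ σ then 1 else 0 := by
    intro σ τ
    have h1 : ∀ c : Fin t → Fin N, c ∘ τ = c ∘ σ ↔ c ∘ (τ * σ⁻¹ : Equiv.Perm (Fin t)) = c := by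
      intro c
      constructor
      · intro h
        funext y
        have := congrFun h (σ⁻¹ y)
        simpa using this
      · intro h
        funext y
        have := congrFun h (σ y)
        simpa using this
    simp only [h1]
    rw [Finset.sum_boole, cyc_mul_comm, ← Fintype.card_subtype, card_invariant_colourings]
    push_cast
    rfl
  -- The squared Hilbert–Schmidt norm of `w` is the Gram form evaluated at `x`, which vanishes by
  -- `hx`.
  have hsum : ∑ c, ∑ d, conj (w c d) * w c d = 0 := by
    have h2 : ∀ c, ∑ d, conj (w c d) * w c d =
        ∑ σ : Equiv.Perm (Fin t), ∑ τ : Equiv.Perm (Fin t), conj (x σ) * ((if c ∘ τ = c ∘ σ then 1 else 0) * x τ) := by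
      intro c
      calc ∑ d, conj (w c d) * w c d
          = ∑ d, ∑ σ : Equiv.Perm (Fin t), (if c ∘ σ = d then conj (x σ) * w c d else 0) := by
            refine Finset.sum_congr rfl fun d _ => ?_
            conv_lhs => enter [1]; rw [show w c d = ∑ τ : Equiv.Perm (Fin t),
              if c ∘ τ = d then x τ else 0 from rfl]
            rw [map_sum, Finset.sum_mul]
            refine Finset.sum_congr rfl fun σ _ => ?_
            split_ifs <;> simp
        _ = ∑ σ : Equiv.Perm (Fin t), conj (x σ) * w c (c ∘ σ) := by
            rw [Finset.sum_comm]
            simp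
        _ = _ := by
            refine Finset.sum_congr rfl fun σ _ => ?_
            rw [← Finset.mul_sum]
            simp only [w, ite_mul, one_mul, zero_mul]
    simp only [h2]
    rw [Finset.sum_comm]
    refine Finset.sum_eq_zero fun σ _ => ?_
    rw [Finset.sum_comm]
    simp only [← Finset.mul_sum, ← Finset.sum_mul, ← hcount, hx, mul_zero]
  have hw : ∀ c d, w c d = 0 := by
    have h3 : ∑ c, ∑ d, Complex.normSq (w c d) = 0 := by
      have : ((∑ c, ∑ d, Complex.normSq (w c d) : ℝ) : ℂ) = 0 := by
        rw [← hsum]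
        push_cast
        simp only [Complex.normSq_eq_conj_mul_self]
      exact_mod_cast this
    intro c d
    rw [Finset.sum_eq_zero_iff_of_nonneg
      fun c _ => Finset.sum_nonneg fun d _ => Complex.normSq_nonneg _] at h3
    have h4 := h3 c (Finset.mem_univ _)
    rw [Finset.sum_eq_zero_iff_of_nonneg fun d _ => Complex.normSq_nonneg _] at h4
    exact Complex.normSq_eq_zero.mp (h4 d (Finset.mem_univ _))
  funext σ
  -- An injective colouring, available since `t ≤ N`, has distinct images under distinct
  -- permutations, so this entry is `x σ` alone.
  have h5 := hw (Fin.castLE htN) (Fin.castLE htN ∘ σ)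
  have h6 : ∀ τ : Equiv.Perm (Fin t),
      Fin.castLE htN ∘ τ = Fin.castLE htN ∘ σ ↔ τ = σ := fun τ =>
    ⟨fun h => Equiv.ext fun y => Fin.castLE_injective htN (congrFun h y), fun h => h ▸ rfl⟩
  simpa only [w, h6, Finset.sum_ite_eq', Finset.mem_univ, if_true, Pi.zero_apply] using h5

end Cycles

/-! ### The convolution inverse and the dual bases -/

section Weingarten

variable {t : ℕ}

theorem pow_cyc_mul_comm (N : ℕ) (σ τ : Equiv.Perm (Fin t)) :
    (N : ℂ) ^ cyc (σ * τ) = (N : ℂ) ^ cyc (τ * σ) := by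
  rw [cyc_mul_comm]

theorem sum_pow_cyc_mul (N : ℕ) (χ : IrrChar (Equiv.Perm (Fin t))) (α : Equiv.Perm (Fin t)) :
    ∑ σ, (N : ℂ) ^ cyc σ * χ.1 (α * σ) = f χ N * χ.1 α :=
  χ.sum_mul_apply_mul (pow_cyc_mul_comm N) α

/-- If the scalar vanished, `χ` would lie in the kernel of the nonsingular matrix, contradicting
`χ(1) ≠ 0`. -/
theorem f_ne_zero {N : ℕ} (htN : t ≤ N) (χ : IrrChar (Equiv.Perm (Fin t))) : f χ N ≠ 0 := by
  intro hf
  have hχ : χ.1 = 0 := by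
    refine eq_zero_of_cyc_convolution_eq_zero htN _ fun σ => ?_
    have h := sum_pow_cyc_mul N χ σ
    rw [hf, zero_mul] at h
    rw [← h]
    exact Fintype.sum_equiv (Equiv.mulLeft σ⁻¹) _ _ fun τ => by simp
  exact χ.one_ne_zero (congrFun hχ 1)

theorem V_mul_comm (N : ℕ) (σ τ : Equiv.Perm (Fin t)) : V N (σ * τ) = V N (τ * σ) :=
  Finset.sum_congr rfl fun χ _ => by rw [χ.mul_comm]

/-- `V_N` is the convolution inverse of `σ ↦ N ^ cyc σ`. -/
theorem sum_V_mul_pow_cyc {N : ℕ} (htN : t ≤ N) (α : Equiv.Perm (Fin t)) :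
    ∑ σ : Equiv.Perm (Fin t), V N (α * σ⁻¹) * (N : ℂ) ^ cyc σ = if α = 1 then 1 else 0 := by
  have ht : (t ! : ℂ) ≠ 0 := by exact_mod_cast t.factorial_ne_zero
  calc ∑ σ : Equiv.Perm (Fin t), V N (α * σ⁻¹) * (N : ℂ) ^ cyc σ
      = ∑ σ : Equiv.Perm (Fin t), V N (α * σ) * (N : ℂ) ^ cyc σ :=
        Fintype.sum_equiv (Equiv.inv _) _ _ fun σ => by simp [cyc_inv]
    _ = ∑ χ : IrrChar (Equiv.Perm (Fin t)), χ.1 1 / ((t ! : ℂ) * f χ N) *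
          ∑ σ : Equiv.Perm (Fin t), (N : ℂ) ^ cyc σ * χ.1 (α * σ) := by
        simp only [V, Finset.sum_mul, Finset.mul_sum]
        rw [Finset.sum_comm]
        exact Finset.sum_congr rfl fun χ _ => Finset.sum_congr rfl fun σ _ => by ring
    _ = (t ! : ℂ)⁻¹ * ∑ χ : IrrChar (Equiv.Perm (Fin t)), χ.1 1 * χ.1 α := by
        rw [Finset.mul_sum]
        refine Finset.sum_congr rfl fun χ _ => ?_
        have := f_ne_zero htN χ
        rw [sum_pow_cyc_mul]
        field_simp
    _ = if α = 1 then 1 else 0 := by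
        rw [sum_irrChar_one_mul, Nat.card_perm, Nat.card_fin]
        split_ifs
        · exact inv_mul_cancel₀ ht
        · exact mul_zero _

/-- This is the convolution identity at `β⁻¹ * α`, reindexed by `σ ↦ β⁻¹ * σ`. Conjugating the whole
identity absorbs the conjugate on `V`, as the powers of `N` and the value 0 or 1 are real. -/
theorem pairing_vTrans_qTrans {N : ℕ} (htN : t ≤ N) (α β : Equiv.Perm (Fin t)) :
    pairing (vTrans N α) (qTrans N β) = if α = β then 1 else 0 := by
  have h := congrArg conj (sum_V_mul_pow_cyc htN (β⁻¹ * α))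
  have h1 : β⁻¹ * α = 1 ↔ α = β := by rw [inv_mul_eq_one, eq_comm]
  rw [map_sum] at h
  rw [show (if α = β then (1 : ℂ) else 0) = conj (if β⁻¹ * α = 1 then (1 : ℂ) else 0) by
    simp only [h1]; split_ifs <;> simp, ← h]
  refine Fintype.sum_equiv (Equiv.mulLeft β⁻¹) _ _ fun σ => ?_
  have h2 : V N (σ⁻¹ * α) = V N (β⁻¹ * α * (β⁻¹ * σ)⁻¹) := by
    rw [V_mul_comm N (β⁻¹ * α), show (β⁻¹ * σ)⁻¹ * (β⁻¹ * α) = σ⁻¹ * α by group]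
  have h3 : cyc (σ⁻¹ * β) = cyc (β⁻¹ * σ) := by
    rw [← cyc_inv, show (σ⁻¹ * β)⁻¹ = β⁻¹ * σ by group]
  simp [vTrans, qTrans, h2, h3]

theorem pairing_sum_smul_right {ι : Type*} (s : Finset ι) (c : ι → ℂ)
    (u : Equiv.Perm (Fin t) → ℂ) (v : ι → Equiv.Perm (Fin t) → ℂ) :
    pairing u (∑ i ∈ s, c i • v i) = ∑ i ∈ s, c i * pairing u (v i) := by
  simp only [pairing, Finset.sum_apply, Pi.smul_apply, smul_eq_mul, Finset.mul_sum]
  rw [Finset.sum_comm]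
  exact Finset.sum_congr rfl fun i _ => Finset.sum_congr rfl fun σ _ => by ring

theorem pairing_conj_symm (u v : Equiv.Perm (Fin t) → ℂ) :
    conj (pairing u v) = pairing v u := by
  simp [pairing, mul_comm]

/-- A family that is dual to another one for the pairing is linearly independent. -/
theorem linearIndependent_of_pairing {u v : Equiv.Perm (Fin t) → Equiv.Perm (Fin t) → ℂ}
    (h : ∀ α β, pairing (u α) (v β) = if α = β then 1 else 0) : LinearIndependent ℂ v := by
  rw [Fintype.linearIndependent_iff]
  intro c hc α
  have h1 := pairing_sum_smul_right Finset.univ c (u α) v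
  have h0 : pairing (u α) 0 = 0 := by simp [pairing]
  rw [hc, h0] at h1
  simpa [h] using h1.symm

end Weingarten

end CUE

theorem mainTheorem12 (t N : ℕ) (htN : t ≤ N) :
    -- the denominators in the definition of `V_N` do not vanish
    (∀ χ : CUE.IrrChar (Equiv.Perm (Fin t)), CUE.f χ N ≠ 0) ∧
    -- the `q_α` and the `V_α` are bases of the space of functions `S_t → ℂ`, dual to each other
    (∃ bq bV : Module.Basis (Equiv.Perm (Fin t)) ℂ (Equiv.Perm (Fin t) → ℂ),
      (∀ α, bq α = CUE.qTrans N α) ∧ (∀ α, bV α = CUE.vTrans N α) ∧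
      ∀ α β, CUE.pairing (bV α) (bq β) = if α = β then 1 else 0) ∧
    -- the convolution identity
    (∀ α : Equiv.Perm (Fin t),
      ∑ σ : Equiv.Perm (Fin t), CUE.V N (α * σ⁻¹) * (N : ℂ) ^ CUE.cyc σ =
        if α = 1 then 1 else 0) := by
  have hp := CUE.pairing_vTrans_qTrans htN
  have hp' : ∀ α β : Equiv.Perm (Fin t),
      CUE.pairing (CUE.qTrans N α) (CUE.vTrans N β) = if α = β then 1 else 0 := by
    intro α β
    rw [← CUE.pairing_conj_symm, hp]
    simp only [eq_comm (a := β)]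
    split_ifs <;> simp
  -- Each family has as many members as the dimension, so independence suffices for a basis.
  have hcard : Fintype.card (Equiv.Perm (Fin t)) =
      Module.finrank ℂ (Equiv.Perm (Fin t) → ℂ) := by simp
  refine ⟨CUE.f_ne_zero htN, ⟨
    basisOfLinearIndependentOfCardEqFinrank (CUE.linearIndependent_of_pairing hp) hcard,
    basisOfLinearIndependentOfCardEqFinrank (CUE.linearIndependent_of_pairing hp') hcard,
    fun α => by simp, fun α => by simp, fun α β => by simpa using hp α β⟩,
    CUE.sum_V_mul_pow_cyc htN⟩
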